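/- Let $K$ be one of the real algebras $A_0=\mathbb{R}$, $A_1=\mathbb{C}$, $A_2=\mathbb{H}$, $A_3=\mathbb{O}$, $A_4=\mathbb{S}$, $\dots$ obtained by iterating the Cayley–Dickson doubling of $\mathbb{R}$, with its Euclidean topology. Let $Y$ be a compact Hausdorff space and $g\colon Y\to Y$ a continuous map. Let $R=C(Y)$ be the (not necessarily associative) ring of continuous functions $Y\to K$ with pointwise operations, and define $\delta\colon R\to R$ by $\delta(f)=f\circ g-f$ (this is $\delta_{\sigma(g)}=\sigma(g)-\mathrm{id}_R$, where $\sigma(g)(f)=f\circ g$). Let $D=C(Y)[X;\mathrm{id}_{C(Y)},\delta_{\sigma(g)}]$ be the unital, not necessarily associative ring whose additive group is that of formal polynomials $\sum_n a_nX^n$ with $a_n\in R$, with the biadditive product determined by $$aX^m\cdot bX^n=\sum_{i} a\,\pi_i^m(b)\,X^{i+n}\qquad(a,b\in R,\ m,n\in\mathbb{N}),$$ where $\pi_i^m$ is the sum of all $\binom{m}{i}$ compositions of $i$ copies of $\mathrm{id}_R$ and $m-i$ copies of $\delta$ (and $\pi_i^m=0$ for $i>m$). Suppose that the action of $g$ on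 $Y$ is minimal, that is, $\emptyset$ and $Y$ are the only closed subsets $Z\subseteq Y$ with $g(Z)\subseteq Z$, and that the topology on $Y$ is not discrete. Then $D$ is simple, that is, $D\neq\{0\}$ and its only two-sided ideals are $\{0\}$ and $D$. Moreover, let $Z(D)$ be the center of $D$, that is, the set of elements that commute with all elements of $D$ and associate, in every position, with all pairs of elements of $D$; identify $k\in K$ with the degree-zero polynomial whose coefficient is the constant function $k$. Then $Z(D)=\mathbb{C}$ if $K=\mathbb{C}$, and $Z(D)=\mathbb{R}$ otherwise. -/

import Mathlib

open Finset

noncomputable section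

/-! ### Cayley-Dickson algebras -/

/-- The Cayley-Dickson double of `A`: pairs `(a, b)` of elements of `A`. -/
@[ext]
structure CDDouble (A : Type) where
  fst : A
  snd : A

namespace CDDouble

variable {A : Type}

instance [Zero A] : Zero (CDDouble A) := ⟨⟨0, 0⟩⟩
instance [Zero A] [One A] : One (CDDouble A) := ⟨⟨1, 0⟩⟩
instance [Add A] : Add (CDDouble A) := ⟨fun x y => ⟨x.fst + y.fst, x.snd + y.snd⟩⟩
instance [Neg A] : Neg (CDDouble A) := ⟨fun x => ⟨-x.fst, -x.snd⟩⟩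
instance [SMul ℝ A] : SMul ℝ (CDDouble A) := ⟨fun r x => ⟨r • x.fst, r • x.snd⟩⟩

/-- `(a, b) (c, d) = (a c - d b*, a* d + c b)`. -/
instance [NonAssocRing A] [Star A] : Mul (CDDouble A) :=
  ⟨fun x y => ⟨x.fst * y.fst - y.snd * star x.snd, star x.fst * y.snd + y.fst * x.snd⟩⟩

/-- `(a, b)* = (a*, -b)`. -/
instance [Star A] [Neg A] : Star (CDDouble A) := ⟨fun x => ⟨star x.fst, -x.snd⟩⟩

@[simp] theorem zero_fst [Zero A] : (0 : CDDouble A).fst = 0 := rfl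
@[simp] theorem zero_snd [Zero A] : (0 : CDDouble A).snd = 0 := rfl
@[simp] theorem one_fst [Zero A] [One A] : (1 : CDDouble A).fst = 1 := rfl
@[simp] theorem one_snd [Zero A] [One A] : (1 : CDDouble A).snd = 0 := rfl
@[simp] theorem add_fst [Add A] (x y : CDDouble A) : (x + y).fst = x.fst + y.fst := rfl
@[simp] theorem add_snd [Add A] (x y : CDDouble A) : (x + y).snd = x.snd + y.snd := rfl
@[simp] theorem neg_fst [Neg A] (x : CDDouble A) : (-x).fst = -x.fst := rfl
@[simp] theorem neg_snd [Neg A] (x : CDDouble A) : (-x).snd = -x.snd := rfl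
@[simp] theorem smul_fst [SMul ℝ A] (r : ℝ) (x : CDDouble A) : (r • x).fst = r • x.fst := rfl
@[simp] theorem smul_snd [SMul ℝ A] (r : ℝ) (x : CDDouble A) : (r • x).snd = r • x.snd := rfl
@[simp] theorem mul_fst [NonAssocRing A] [Star A] (x y : CDDouble A) :
    (x * y).fst = x.fst * y.fst - y.snd * star x.snd := rfl
@[simp] theorem mul_snd [NonAssocRing A] [Star A] (x y : CDDouble A) :
    (x * y).snd = star x.fst * y.snd + y.fst * x.snd := rfl
@[simp] theorem star_fst [Star A] [Neg A] (x : CDDouble A) : (star x).fst = star x.fst := rfl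
@[simp] theorem star_snd [Star A] [Neg A] (x : CDDouble A) : (star x).snd = -x.snd := rfl

instance [NonAssocRing A] [StarRing A] : NonAssocRing (CDDouble A) where
  add_assoc x y z := by ext <;> simp [add_assoc]
  zero_add x := by ext <;> simp
  add_zero x := by ext <;> simp
  add_comm x y := by ext <;> simp [add_comm]
  neg_add_cancel x := by ext <;> simp
  nsmul := nsmulRec
  zsmul := zsmulRec
  left_distrib x y z := by ext <;> simp [mul_add, add_mul] <;> abel
  right_distrib x y z := by ext <;> simp [mul_add, add_mul] <;> abel
  zero_mul x := by ext <;> simp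
  mul_zero x := by ext <;> simp
  one_mul x := by ext <;> simp
  mul_one x := by ext <;> simp

instance [NonAssocRing A] [StarRing A] : StarRing (CDDouble A) where
  star_involutive x := by ext <;> simp
  star_mul x y := by ext <;> simp [add_comm]
  star_add x y := by ext <;> simp [add_comm]

instance [NonAssocRing A] [StarRing A] [Module ℝ A] : Module ℝ (CDDouble A) where
  one_smul x := by ext <;> simp
  mul_smul r s x := by ext <;> simp [mul_smul]
  smul_zero r := by ext <;> simp
  smul_add r x y := by ext <;> simp
  add_smul r s x := by ext <;> simp [add_smul]
  zero_smul x := by ext <;> simp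

/-- The product topology. -/
instance [TopologicalSpace A] : TopologicalSpace (CDDouble A) :=
  TopologicalSpace.induced (fun x => (x.fst, x.snd)) inferInstance

theorem continuous_fst [TopologicalSpace A] : Continuous (fst : CDDouble A → A) :=
  _root_.continuous_fst.comp (f := fun x : CDDouble A => (x.fst, x.snd)) continuous_induced_dom

theorem continuous_snd [TopologicalSpace A] : Continuous (snd : CDDouble A → A) :=
  _root_.continuous_snd.comp (f := fun x : CDDouble A => (x.fst, x.snd)) continuous_induced_dom

theorem continuous_mk [TopologicalSpace A] {X : Type*} [TopologicalSpace X] {u v : X → A}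
    (hu : Continuous u) (hv : Continuous v) :
    Continuous (fun x => (⟨u x, v x⟩ : CDDouble A)) :=
  continuous_induced_rng.2 (hu.prodMk hv)

variable [NonAssocRing A] [StarRing A] [TopologicalSpace A] [IsTopologicalRing A]
  [ContinuousStar A]

instance : IsTopologicalRing (CDDouble A) where
  continuous_add := by
    have h1 := continuous_fst (A := A)
    have h2 := continuous_snd (A := A)
    exact continuous_mk (by fun_prop) (by fun_prop)
  continuous_mul := by
    have h1 := continuous_fst (A := A)
    have h2 := continuous_snd (A := A)
    exact continuous_mk (by fun_prop) (by fun_prop)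
  continuous_neg := by
    have h1 := continuous_fst (A := A)
    have h2 := continuous_snd (A := A)
    exact continuous_mk (by fun_prop) (by fun_prop)

instance : ContinuousStar (CDDouble A) where
  continuous_star := by
    have h1 := continuous_fst (A := A)
    have h2 := continuous_snd (A := A)
    exact continuous_mk (by fun_prop) (by fun_prop)

end CDDouble

/-- A topological (not necessarily associative) real algebra with involution; used only to
carry the whole structure through the recursion that defines the Cayley-Dickson tower. -/
structure CDObj where
  carrier : Type
  [ring : NonAssocRing carrier]
  [starRing : StarRing carrier]
  [module : Module ℝ carrier]
  [top : TopologicalSpace carrier]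
  [topRing : IsTopologicalRing carrier]
  [contStar : ContinuousStar carrier]

attribute [instance] CDObj.ring CDObj.starRing CDObj.module CDObj.top CDObj.topRing
  CDObj.contStar

/-- The Cayley-Dickson tower over `ℝ` (with the trivial involution). -/
def cdTower : ℕ → CDObj
  | 0 => { carrier := ℝ }
  | n + 1 => { carrier := CDDouble (cdTower n).carrier }

/-- The `n`-th Cayley-Dickson algebra, of real dimension `2 ^ n`: the reals (`n = 0`), the
complex numbers (`n = 1`), the quaternions (`n = 2`), the octonions (`n = 3`),
the sedenions (`n = 4`), and so on. -/
abbrev CDAlgebra (n : ℕ) : Type := (cdTower n).carrier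

/-! ### Generalized polynomial rings over a non-associative ring -/

/-- Additive maps `σ, δ : R → R` with `σ 1 = 1` and `δ 1 = 0`. -/
structure OreData (R : Type*) [NonAssocRing R] where
  sigma : R →+ R
  delta : R →+ R
  sigma_one : sigma 1 = 1
  delta_one : delta 1 = 0

namespace OreData

variable {R : Type*} [NonAssocRing R] (P : OreData R)

/-- The composition of `σ`s and `δ`s prescribed by a word of length `m`
(`true` stands for `σ`, `false` for `δ`). -/
def word {m : ℕ} (w : Fin m → Bool) : R →+ R :=
  (List.ofFn fun j => if w j then P.sigma else P.delta).foldr AddMonoidHom.comp (AddMonoidHom.id R)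

/-- `π_i^m`: the sum of all compositions of `i` copies of `σ` and `m - i` copies of `δ`,
in arbitrary order (hence `0` if `m < i`). -/
def piMap (m i : ℕ) : R →+ R :=
  ∑ w : Fin m → Bool with #{j | w j = true} = i, P.word w

theorem word_one {m : ℕ} (w : Fin m → Bool) :
    P.word w 1 = if ∀ j, w j = true then 1 else 0 := by
  induction m with
  | zero => simp [word]
  | succ m ih =>
    have h : P.word w = (if w 0 then P.sigma else P.delta).comp (P.word (fun j => w j.succ)) := by
      simp [word, List.ofFn_succ]
    rw [h, AddMonoidHom.comp_apply, ih]
    simp only [Fin.forall_fin_succ]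
    by_cases h0 : w 0 = true <;> by_cases h1 : ∀ j : Fin m, w j.succ = true <;>
      simp [h0, h1, P.sigma_one, P.delta_one]

theorem piMap_one (m i : ℕ) : P.piMap m i 1 = if i = m then 1 else 0 := by
  have h : P.piMap m i 1 = ∑ w : Fin m → Bool with #{j | w j = true} = i, P.word w 1 := by
    simp only [piMap]
    exact AddMonoidHom.finsetSum_apply _ _ _
  rw [h]
  simp only [word_one]
  rw [Finset.sum_filter, Finset.sum_eq_single (fun _ => true)]
  · simp [eq_comm]
  · intro w _ hw
    have : ¬ ∀ j, w j = true := fun h => hw (funext h)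
    simp [this]
  · simp

theorem piMap_zero_zero : P.piMap 0 0 = AddMonoidHom.id R := by
  simp [piMap, word]

end OreData

/-- The underlying set of the generalized polynomial ring `R[X ; σ, δ]`: finitely supported
sequences of coefficients, `f` standing for `∑ f n X ^ n`. -/
def OrePoly {R : Type*} [NonAssocRing R] (_P : OreData R) : Type _ := ℕ →₀ R

namespace OrePoly

variable {R : Type*} [NonAssocRing R] (P : OreData R)

instance : AddCommGroup (OrePoly P) := inferInstanceAs (AddCommGroup (ℕ →₀ R))

/-- The monomial `a X ^ n`. -/
def monomial (n : ℕ) : R →+ OrePoly P := Finsupp.singleAddHom n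

/-- The element `r = r X ^ 0` of `R[X ; σ, δ]`. -/
def const : R →+ OrePoly P := monomial P 0

theorem monomial_zero (n : ℕ) : monomial P n 0 = 0 := map_zero _

/-- The biadditive extension of the product of monomials
`(a X ^ m) (b X ^ n) = ∑ i, (a π_i^m(b)) X ^ (i + n)`, where `π_i^m = 0` for `m < i`. -/
instance : Mul (OrePoly P) :=
  ⟨fun f g => Finsupp.sum f fun m a => Finsupp.sum g fun n b =>
    ∑ i ∈ range (m + 1), monomial P (i + n) (a * P.piMap m i b)⟩

instance : One (OrePoly P) := ⟨const P 1⟩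

theorem mul_def (f g : OrePoly P) :
    f * g = Finsupp.sum f fun m a => Finsupp.sum g fun n b =>
      ∑ i ∈ range (m + 1), monomial P (i + n) (a * P.piMap m i b) := rfl

theorem one_def : (1 : OrePoly P) = monomial P 0 1 := rfl

protected theorem zero_mul (f : OrePoly P) : 0 * f = 0 := Finsupp.sum_zero_index

protected theorem mul_zero (f : OrePoly P) : f * 0 = 0 := by
  rw [mul_def]
  exact Finset.sum_eq_zero fun m _ => Finsupp.sum_zero_index

protected theorem add_mul (f g h : OrePoly P) : (f + g) * h = f * h + g * h := by
  simp only [mul_def]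
  refine Finsupp.sum_add_index' (fun m => ?_) (fun m a b => ?_)
  · simp [Finsupp.sum]
  · simp [Finsupp.sum, add_mul, Finset.sum_add_distrib]

protected theorem mul_add (f g h : OrePoly P) : f * (g + h) = f * g + f * h := by
  simp only [mul_def]
  refine Eq.trans (Finset.sum_congr rfl fun m _ => ?_) Finset.sum_add_distrib
  refine Finsupp.sum_add_index' (fun n => ?_) (fun n a b => ?_)
  · simp
  · simp [mul_add, Finset.sum_add_distrib]

theorem monomial_mul_monomial (m n : ℕ) (a b : R) :
    monomial P m a * monomial P n b =
      ∑ i ∈ range (m + 1), monomial P (i + n) (a * P.piMap m i b) := by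
  rw [mul_def]
  refine (Finsupp.sum_single_index (by simp [Finsupp.sum])).trans ?_
  exact Finsupp.sum_single_index (by simp)

theorem induction_on {C : OrePoly P → Prop} (f : OrePoly P) (h0 : C 0)
    (hm : ∀ n a, C (monomial P n a)) (ha : ∀ f g, C f → C g → C (f + g)) : C f :=
  Finsupp.induction_linear (motive := C) f h0 (fun f g => ha f g) (fun n a => hm n a)

instance : NonAssocRing (OrePoly P) where
  left_distrib := OrePoly.mul_add P
  right_distrib := OrePoly.add_mul P
  zero_mul := OrePoly.zero_mul P
  mul_zero := OrePoly.mul_zero P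
  one_mul f := by
    refine OrePoly.induction_on P (C := fun f => 1 * f = f) f (OrePoly.mul_zero P 1) (fun n a => ?_) (fun f g hf hg => ?_)
    · simp [one_def, monomial_mul_monomial, P.piMap_zero_zero]
    · rw [OrePoly.mul_add, hf, hg]
  mul_one f := by
    refine OrePoly.induction_on P (C := fun f => f * 1 = f) f (OrePoly.zero_mul P 1) (fun n a => ?_) (fun f g hf hg => ?_)
    · rw [one_def, monomial_mul_monomial, Finset.sum_eq_single n]
      · simp [P.piMap_one]
      · intro i _ hi
        simp [P.piMap_one, hi]
      · simp
    · rw [OrePoly.add_mul, hf, hg]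

end OrePoly

/-- For a ring endomorphism `α` of `R`: the data `σ = id` and `δ = δ_α`, where
`δ_α(r) = α(r) - r`. -/
def OreData.ofRingHom {R : Type*} [NonAssocRing R] (α : R →+* R) : OreData R where
  sigma := AddMonoidHom.id R
  delta := α.toAddMonoidHom - AddMonoidHom.id R
  sigma_one := rfl
  delta_one := by simp [AddMonoidHom.sub_apply]

/-! ### The differential polynomial ring of a dynamical system -/

/-- The ring homomorphism `σ(g) : f ↦ f ∘ g` on `C(Y)`, the ring of continuous functions from
`Y` to a topological ring `K`. -/
def compHom {Y : Type*} [TopologicalSpace Y] (K : Type*) [NonAssocRing K] [TopologicalSpace K]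
    [IsTopologicalRing K] (g : C(Y, Y)) : C(Y, K) →+* C(Y, K) where
  toFun f := f.comp g
  map_one' := rfl
  map_mul' _ _ := rfl
  map_zero' := rfl
  map_add' _ _ := rfl

/-- `C(Y)[X ; id, δ_{σ(g)}]`, where `C(Y)` is the ring of continuous functions from `Y` to the
`n`-th Cayley-Dickson algebra. -/
abbrev DynPoly {Y : Type*} [TopologicalSpace Y] (n : ℕ) (g : C(Y, Y)) : Type _ :=
  OrePoly (OreData.ofRingHom (compHom (CDAlgebra n) g))

/-- The element of `C(Y)[X ; id, δ_{σ(g)}]` given by the scalar `k`, that is, the polynomial of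
degree zero whose coefficient is the constant function with value `k`. -/
def DynPoly.scalar {Y : Type*} [TopologicalSpace Y] (n : ℕ) (g : C(Y, Y)) (k : CDAlgebra n) :
    DynPoly n g :=
  OrePoly.const _ (ContinuousMap.const Y k)

/-- The action of `g` on `Y` is minimal: `∅` and `Y` are the only closed subsets `Z` with
`g(Z) ⊆ Z`. -/
def IsMinimalMap {Y : Type*} [TopologicalSpace Y] (g : C(Y, Y)) : Prop :=
  ∀ Z : Set Y, IsClosed Z → g '' Z ⊆ Z → Z = ∅ ∨ Z = Set.univ

end

/-! Take a nonzero ideal of D and let N be the least degree of its nonzero elements. The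
coefficients at X^N of its elements of degree at most N form a two-sided ideal S of C(Y), stable
under composition with g because commuting with X applies δ to each coefficient. Minimality and
compactness force 1 ∈ S (`IsMinimalMap.one_mem`): products f f* are real and nonnegative, and a
finite sum of them is invertible. The resulting monic q commutes with every real-valued r, since q r
- r q has degree below N. The coefficient of X^(N-1) in q r - r q is N(r ∘ g - r), nonzero for some
r, so N = 0 and q = 1.

A central element has g-invariant, hence constant, coefficients, and the same commutator computation
puts it in degree zero (`IsMinimalMap.center_eq`). What remains is the centre of K.

Division and associativity are never needed in K, which may have zero divisors; the real norm x x*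
replaces them. -/

/-! ### Norms and centres of the Cayley-Dickson algebras -/

/-- A topological real `*`-algebra, not necessarily associative, in which `x x* = x* x` is a real
multiple of `1` that depends continuously on `x` and vanishes only at `x = 0`. -/
class IsQuadraticStarAlgebra (A : Type) [NonAssocRing A] [StarRing A] [Module ℝ A]
    [TopologicalSpace A] : Prop extends IsScalarTower ℝ A A, SMulCommClass ℝ A A,
    StarModule ℝ A, ContinuousSMul ℝ A, T2Space A, Nontrivial A where
  exists_normSq : ∃ N : A → ℝ, Continuous N ∧ (∀ x, 0 ≤ N x) ∧ (∀ x, N x = 0 → x = 0) ∧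
    (∀ x, x * star x = N x • (1 : A)) ∧ ∀ x, star x * x = N x • (1 : A)

instance : IsQuadraticStarAlgebra ℝ where
  exists_normSq := ⟨fun x => x * x, by fun_prop, fun x => mul_self_nonneg x,
    fun x hx => mul_self_eq_zero.1 hx, fun x => by simp, fun x => by simp⟩

theorem eq_zero_of_neg_eq_self {M : Type*} [AddCommGroup M] [Module ℝ M] {x : M} (h : -x = x) :
    x = 0 := by
  have h2 : (2 : ℝ) • x = 0 := by
    rw [two_smul]
    nth_rewrite 1 [← h]
    exact neg_add_cancel x
  exact (smul_eq_zero.1 h2).resolve_left two_ne_zero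

namespace CDDouble

variable {A : Type} [NonAssocRing A] [StarRing A]

@[simp] theorem sub_fst (x y : CDDouble A) : (x - y).fst = x.fst - y.fst := by
  simp [sub_eq_add_neg]

@[simp] theorem sub_snd (x y : CDDouble A) : (x - y).snd = x.snd - y.snd := by
  simp [sub_eq_add_neg]

instance [Module ℝ A] [TopologicalSpace A] [IsTopologicalRing A] [ContinuousStar A]
    [IsQuadraticStarAlgebra A] : IsQuadraticStarAlgebra (CDDouble A) where
  smul_assoc r x y := by
    ext <;> simp [smul_sub, smul_add, smul_mul_assoc, mul_smul_comm]
  smul_comm r x y := by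
    ext <;> simp [smul_sub, smul_add, smul_mul_assoc, mul_smul_comm]
  star_smul r x := by ext <;> simp
  continuous_smul := by
    have h1 := continuous_fst (A := A)
    have h2 := continuous_snd (A := A)
    exact continuous_mk (by fun_prop) (by fun_prop)
  t2 := (T2Space.of_injective_continuous (f := fun x : CDDouble A => (x.fst, x.snd))
    (fun x y h => CDDouble.ext (congrArg Prod.fst h) (congrArg Prod.snd h))
    continuous_induced_dom).t2
  exists_pair_ne := ⟨0, 1, fun h => zero_ne_one (congrArg fst h)⟩
  exists_normSq := by
    obtain ⟨N, hc, h0, hN, hl, hr⟩ := IsQuadraticStarAlgebra.exists_normSq (A := A)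
    -- Only x x* and x* x occur, and their components involve no triple products. Neither
    -- associativity nor alternativity is used, so the induction survives beyond the octonions.
    refine ⟨fun x => N x.fst + N x.snd,
      (hc.comp continuous_fst).add (hc.comp continuous_snd),
      fun x => add_nonneg (h0 _) (h0 _), fun x hx => ?_, fun x => ?_, fun x => ?_⟩
    · obtain ⟨h1, h2⟩ := (add_eq_zero_iff_of_nonneg (h0 x.fst) (h0 x.snd)).1 hx
      exact CDDouble.ext (hN _ h1) (hN _ h2)
    · ext <;> simp [hl, add_smul]
    · ext <;> simp [hl, hr, add_smul]

variable [Module ℝ A]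

/-- If the self-adjoint elements of `A` are real, then so are those of its double. -/
theorem exists_eq_smul_one_of_star_eq
    (hA : ∀ a : A, star a = a → ∃ r : ℝ, a = r • (1 : A)) (x : CDDouble A) (hx : star x = x) :
    ∃ r : ℝ, x = r • (1 : CDDouble A) := by
  obtain ⟨r, hr⟩ := hA x.fst (congrArg fst hx)
  have h2 : -x.snd = x.snd := congrArg snd hx
  have h3 : x.snd = 0 := eq_zero_of_neg_eq_self h2
  exact ⟨r, CDDouble.ext (by simpa using hr) (by simpa using h3)⟩

/-- If the self-adjoint elements of the double of `A` are real, then the elements that commute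
with everything in the double of this double are real. -/
theorem exists_eq_smul_one_of_commute
    (hA : ∀ a : CDDouble A, star a = a → ∃ r : ℝ, a = r • (1 : CDDouble A))
    (x : CDDouble (CDDouble A)) (hx : ∀ y, x * y = y * x) :
    ∃ r : ℝ, x = r • (1 : CDDouble (CDDouble A)) := by
  -- Write x = (a, b). Commuting with (0, 1) gives a* = a. For u = (0, 1) in the inner double,
  -- commuting with (u, 0) gives u b = u* b = -u b; as u (c, d) = (-d, c), this forces b = 0.
  have h1 := congrArg snd (hx ⟨0, 1⟩)
  have h2 := congrArg snd (hx ⟨⟨0, 1⟩, 0⟩)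
  obtain ⟨r, hr⟩ := hA x.fst (by simpa using h1)
  have h3 : x.snd = 0 := by
    have h4 := congrArg fst h2
    have h5 := congrArg snd h2
    simp only [mul_fst, mul_snd, star_fst, star_snd, mul_zero, star_zero,
      zero_mul, star_one, mul_one, zero_add, zero_sub, add_zero, mul_neg] at h4 h5
    refine CDDouble.ext (eq_zero_of_neg_eq_self h5.symm) (star_eq_zero.1 ?_)
    exact eq_zero_of_neg_eq_self (by simpa using congrArg star h4)
  exact ⟨r, CDDouble.ext (by simpa using hr) (by simpa using h3)⟩

end CDDouble

instance CDAlgebra.isQuadraticStarAlgebra : ∀ n : ℕ, IsQuadraticStarAlgebra (CDAlgebra n)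
  | 0 => inferInstanceAs (IsQuadraticStarAlgebra ℝ)
  | n + 1 =>
    have := CDAlgebra.isQuadraticStarAlgebra n
    inferInstanceAs (IsQuadraticStarAlgebra (CDDouble (CDAlgebra n)))

theorem CDAlgebra.exists_eq_smul_one_of_star_eq : ∀ (n : ℕ) (x : CDAlgebra n), star x = x →
    ∃ r : ℝ, x = r • (1 : CDAlgebra n)
  | 0, x, _ => ⟨x, (mul_one (x : ℝ)).symm⟩
  | n + 1, x, hx => CDDouble.exists_eq_smul_one_of_star_eq
      (CDAlgebra.exists_eq_smul_one_of_star_eq n) x hx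

/-- The centre of a Cayley-Dickson algebra other than `ℂ` is real. -/
theorem CDAlgebra.exists_eq_smul_one_of_mem_center : ∀ {n : ℕ}, n ≠ 1 → ∀ x : CDAlgebra n,
    x ∈ Set.center (CDAlgebra n) → ∃ r : ℝ, x = r • (1 : CDAlgebra n)
  | 0, _, x, _ => ⟨x, (mul_one (x : ℝ)).symm⟩
  | 1, h, _, _ => absurd rfl h
  | n + 2, _, x, hx => CDDouble.exists_eq_smul_one_of_commute (A := CDAlgebra n)
      (CDAlgebra.exists_eq_smul_one_of_star_eq (n + 1)) x fun y => hx.comm y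

theorem smul_one_mem_center {A : Type} [NonAssocRing A] [StarRing A] [Module ℝ A]
    [TopologicalSpace A] [IsQuadraticStarAlgebra A] (r : ℝ) : r • (1 : A) ∈ Set.center A where
  comm a := by simp [Commute, SemiconjBy, smul_mul_assoc, mul_smul_comm]
  left_assoc a b := by simp [smul_mul_assoc]
  right_assoc a b := by simp [mul_smul_comm]

theorem CDAlgebra.center_one : Set.center (CDAlgebra 1) = Set.univ := by
  refine Set.eq_univ_of_forall fun x => ?_
  have hc : ∀ x y : CDDouble ℝ, x * y = y * x := fun x y => by
    ext <;> simp <;> ring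
  have ha : ∀ x y z : CDDouble ℝ, x * (y * z) = x * y * z := fun x y z => by
    ext <;> simp <;> ring
  exact ⟨fun y => hc x y, fun y z => ha x y z, fun y z => (ha y z x).symm⟩

/-! ### The maps π_i^m when σ is the identity -/

namespace OreData

variable {R : Type*} [NonAssocRing R] {P : OreData R}

theorem word_apply_of_sigma_eq_id (hσ : P.sigma = AddMonoidHom.id R) {m : ℕ} (w : Fin m → Bool)
    (b : R) : P.word w b = P.delta^[m - #{j | w j = true}] b := by
  induction m with
  | zero => simp [word]
  | succ m ih =>
    have h : P.word w = (if w 0 then P.sigma else P.delta).comp (P.word fun j => w j.succ) := by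
      simp [word, List.ofFn_succ]
    have hle : #{j : Fin m | w j.succ = true} ≤ m := (card_filter_le _ _).trans (by simp)
    rw [h, AddMonoidHom.comp_apply, ih, Fin.card_filter_univ_succ]
    by_cases h0 : w 0 = true
    · simp [h0, hσ]
    · have h1 : m + 1 - #{j : Fin m | w j.succ = true} =
          (m - #{j : Fin m | w j.succ = true}) + 1 := by omega
      simp [h0, h1, Function.iterate_succ_apply']

theorem card_bool_fun_filter (m i : ℕ) :
    #{w : Fin m → Bool | #{j | w j = true} = i} = m.choose i := by
  rw [← card_fin m, ← card_powersetCard i (univ : Finset (Fin m)), card_fin]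
  refine card_nbij' (fun w => ({j | w j = true} : Finset (Fin m))) (fun s j => decide (j ∈ s)) ?_ ?_ ?_ ?_
  · intro w hw
    simpa [mem_powersetCard] using hw
  · intro s hs
    simpa [mem_powersetCard] using hs
  · intro w _
    funext j
    simp
  · intro s _
    ext j
    simp

/-- Each word collapses to a power of δ that depends only on the number of its σ letters, and a word
is determined by the positions of those letters. -/
theorem piMap_apply_of_sigma_eq_id (hσ : P.sigma = AddMonoidHom.id R) (m i : ℕ) (b : R) :
    P.piMap m i b = m.choose i • P.delta^[m - i] b := by
  have h : P.piMap m i b = ∑ w : Fin m → Bool with #{j | w j = true} = i, P.word w b := by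
    simp only [piMap]
    exact AddMonoidHom.finsetSum_apply _ _ _
  rw [h, ← card_bool_fun_filter m i, ← sum_const]
  refine sum_congr rfl fun w hw => ?_
  rw [word_apply_of_sigma_eq_id hσ, (mem_filter.1 hw).2]

theorem piMap_eq_zero_of_delta_eq_zero (hσ : P.sigma = AddMonoidHom.id R) {m i : ℕ} (hi : i ≠ m)
    {k : R} (hk : P.delta k = 0) : P.piMap m i k = 0 := by
  rw [piMap_apply_of_sigma_eq_id hσ]
  rcases lt_or_gt_of_ne hi with h | h
  · obtain ⟨j, hj⟩ : ∃ j, m - i = j + 1 := ⟨m - i - 1, by omega⟩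
    have h0 : P.delta^[j] 0 = 0 := iterate_map_zero P.delta j
    rw [hj, Function.iterate_succ_apply, hk, h0, smul_zero]
  · rw [Nat.choose_eq_zero_of_lt h, zero_smul]

theorem piMap_self_of_sigma_eq_id (hσ : P.sigma = AddMonoidHom.id R) (m : ℕ) (b : R) :
    P.piMap m m b = b := by
  simp [piMap_apply_of_sigma_eq_id hσ]

theorem piMap_mul_left (hσ : P.sigma = AddMonoidHom.id R) {k : R}
    (hk : ∀ b, P.delta (k * b) = k * P.delta b) (m i : ℕ) (b : R) :
    P.piMap m i (k * b) = k * P.piMap m i b := by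
  have h : ∀ j, P.delta^[j] (k * b) = k * P.delta^[j] b := fun j =>
    ((show Function.Commute P.delta (k * ·) from hk).iterate_left j) b
  rw [piMap_apply_of_sigma_eq_id hσ, piMap_apply_of_sigma_eq_id hσ, h, mul_smul_comm]

end OreData

/-! ### Coefficients of products, and central constants -/

namespace OrePoly

variable {R : Type*} [NonAssocRing R] {P : OreData R}

/-- The coefficient of `X ^ i`. -/
noncomputable def coeff (i : ℕ) : OrePoly P →+ R := Finsupp.applyAddHom i

theorem coeff_monomial (i n : ℕ) (a : R) :
    coeff i (monomial P n a) = if n = i then a else 0 := Finsupp.single_apply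

theorem ext_coeff {p q : OrePoly P} (h : ∀ i, coeff i p = coeff i q) : p = q := Finsupp.ext h

theorem coeff_const_zero (a : R) : coeff 0 (const P a) = a := by
  rw [const, coeff_monomial, if_pos rfl]

theorem coeff_const_of_ne {i : ℕ} (hi : i ≠ 0) (a : R) : coeff i (const P a) = 0 := by
  rw [const, coeff_monomial, if_neg hi.symm]

theorem eq_const {p : OrePoly P} (h : ∀ i, 0 < i → coeff i p = 0) : p = const P (coeff 0 p) := by
  refine ext_coeff fun i => ?_
  rcases Nat.eq_zero_or_pos i with rfl | hi
  · rw [coeff_const_zero]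
  · rw [h i hi, coeff_const_of_ne hi.ne']

theorem exists_coeff_eq_zero_of_lt (p : OrePoly P) : ∃ N, ∀ i, N < i → coeff i p = 0 := by
  refine ⟨(Finsupp.support (M := R) p).sup id, fun i hi => ?_⟩
  by_contra hne
  exact absurd (le_sup (f := id) (Finsupp.mem_support_iff.2 hne)) (not_le.2 hi)

theorem coeff_const_mul (i : ℕ) (r : R) (p : OrePoly P) :
    coeff i (const P r * p) = r * coeff i p := by
  refine induction_on P (C := fun p => coeff i (const P r * p) = r * coeff i p) p ?_ ?_ ?_
  · simp
  · intro n a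
    simp [const, monomial_mul_monomial, coeff_monomial, P.piMap_zero_zero]
  · intro p q hp hq
    rw [mul_add, map_add, map_add, hp, hq, mul_add]

/-- From X · aX^n = δ(a)X^n + aX^(n+1): the commutator with X is δ applied coefficientwise. This
makes leading-coefficient ideals g-stable and central coefficients g-invariant. -/
theorem coeff_mul_monomial_one (i : ℕ) (p : OrePoly P) (hσ : P.sigma = AddMonoidHom.id R) :
    coeff i (monomial P 1 1 * p) = coeff i (p * monomial P 1 1) + P.delta (coeff i p) := by
  refine induction_on P (C := fun p => coeff i (monomial P 1 1 * p) =
    coeff i (p * monomial P 1 1) + P.delta (coeff i p)) p ?_ ?_ ?_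
  · simp
  · intro n a
    have h1 : monomial P 1 1 * monomial P n a =
        monomial P n (P.delta a) + monomial P (1 + n) a := by
      rw [monomial_mul_monomial, sum_range_succ, sum_range_one]
      simp [OreData.piMap_apply_of_sigma_eq_id hσ]
    have h2 : monomial P n a * monomial P 1 1 = monomial P (n + 1) a := by
      rw [monomial_mul_monomial, sum_eq_single n]
      · simp [P.piMap_one]
      · intro j _ hj
        simp [P.piMap_one, hj]
      · simp
    rw [h1, h2, map_add, add_comm 1 n, add_comm, coeff_monomial i n,
      coeff_monomial i n]
    split_ifs <;> simp
  · intro p q hp hq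
    rw [mul_add, add_mul, map_add, map_add, map_add, map_add, hp, hq]
    abel

theorem coeff_mul_const (hσ : P.sigma = AddMonoidHom.id R) {p : OrePoly P} {N : ℕ}
    (hp : ∀ m, N < m → coeff m p = 0) (i : ℕ) (r : R) :
    coeff i (p * const P r) =
      ∑ m ∈ range (N + 1), coeff m p * (m.choose i • P.delta^[m - i] r) := by
  have h : coeff i (p * const P r) =
      Finsupp.sum p fun m a => a * (m.choose i • P.delta^[m - i] r) := by
    refine induction_on P (C := fun p => coeff i (p * const P r) =
      Finsupp.sum p fun m a => a * (m.choose i • P.delta^[m - i] r)) p ?_ ?_ ?_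
    · rw [zero_mul, map_zero]
      exact Finsupp.sum_zero_index.symm
    · intro n a
      refine Eq.trans ?_ (Finsupp.sum_single_index (zero_mul _)).symm
      rw [const, monomial_mul_monomial, map_sum]
      simp only [add_zero, coeff_monomial, OreData.piMap_apply_of_sigma_eq_id hσ]
      rw [sum_ite_eq']
      split_ifs with hi
      · rfl
      · rw [Nat.choose_eq_zero_of_lt (by simpa using hi), zero_smul, mul_zero]
    · intro p q hp hq
      rw [add_mul, map_add, hp, hq]
      exact (Finsupp.sum_add_index' (fun _ => zero_mul _) (fun _ _ _ => add_mul _ _ _)).symm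
  rw [h]
  refine Finsupp.sum_of_support_subset (M := R) p (fun m hm => ?_) _ (fun _ _ => zero_mul _)
  by_contra hlt
  exact (Finsupp.mem_support_iff.1 hm) (hp m (by simpa using hlt))

theorem coeff_mul_const_of_lt (hσ : P.sigma = AddMonoidHom.id R) {p : OrePoly P} {N i : ℕ}
    (hp : ∀ m, N < m → coeff m p = 0) (hi : N < i) (r : R) : coeff i (p * const P r) = 0 := by
  rw [coeff_mul_const hσ hp]
  refine sum_eq_zero fun m hm => ?_
  rw [Nat.choose_eq_zero_of_lt ((Nat.lt_succ_iff.1 (mem_range.1 hm)).trans_lt hi), zero_smul,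
    mul_zero]

theorem coeff_mul_const_self (hσ : P.sigma = AddMonoidHom.id R) {p : OrePoly P} {N : ℕ}
    (hp : ∀ m, N < m → coeff m p = 0) (r : R) : coeff N (p * const P r) = coeff N p * r := by
  rw [coeff_mul_const hσ hp, sum_range_succ, sum_eq_zero fun m hm => ?_]
  · simp
  · rw [Nat.choose_eq_zero_of_lt (mem_range.1 hm), zero_smul, mul_zero]

/-- The first coefficient below the top is where δ(r) becomes visible; this is what rules out
positive degree. -/
theorem coeff_mul_const_pred (hσ : P.sigma = AddMonoidHom.id R) {p : OrePoly P} {N : ℕ}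
    (hp : ∀ m, N + 1 < m → coeff m p = 0) (r : R) :
    coeff N (p * const P r) = coeff N p * r + (N + 1) • (coeff (N + 1) p * P.delta r) := by
  rw [coeff_mul_const hσ hp, sum_range_succ, sum_range_succ, sum_eq_zero fun m hm => ?_]
  · rw [zero_add, Nat.choose_self, Nat.choose_succ_self_right, Nat.sub_self, Nat.add_sub_cancel_left,
      one_smul, mul_smul_comm]
    rfl
  · rw [Nat.choose_eq_zero_of_lt (mem_range.1 hm), zero_smul, mul_zero]

/-- Constants that are central in `R` and over which `δ` is linear are central in `R[X ; id, δ]`. -/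
theorem const_mem_center (hσ : P.sigma = AddMonoidHom.id R) {k : R} (hk : k ∈ Set.center R)
    (hδ : ∀ b, P.delta (k * b) = k * P.delta b) : const P k ∈ Set.center (OrePoly P) := by
  have h0 : P.delta k = 0 := by simpa [P.delta_one] using hδ 1
  have hl : ∀ n b, const P k * monomial P n b = monomial P n (k * b) := fun n b => by
    simp [const, monomial_mul_monomial, P.piMap_zero_zero]
  have hr : ∀ n b, monomial P n b * const P k = monomial P n (k * b) := fun n b => by
    rw [const, monomial_mul_monomial, sum_eq_single n, OreData.piMap_self_of_sigma_eq_id hσ,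
      (hk.comm b).eq, add_zero]
    · intro i _ hi
      rw [OreData.piMap_eq_zero_of_delta_eq_zero hσ hi h0, mul_zero, monomial_zero]
    · simp
  have hcomm : ∀ p, const P k * p = p * const P k := fun p => by
    refine induction_on P (C := fun p => const P k * p = p * const P k) p (by simp) ?_ ?_
    · intro n a
      rw [hl, hr]
    · intro p q hp hq
      rw [mul_add, add_mul, hp, hq]
  have hleft : ∀ p q, const P k * (p * q) = const P k * p * q := fun p q => by
    refine induction_on P (C := fun p => const P k * (p * q) = const P k * p * q) p (by simp) ?_ ?_
    · intro m a
      refine induction_on P (C := fun q => const P k * (monomial P m a * q) =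
        const P k * monomial P m a * q) q (by simp) ?_ ?_
      · intro n b
        rw [hl, monomial_mul_monomial, monomial_mul_monomial, mul_sum]
        simp only [hl, hk.left_assoc]
      · intro p q hp hq
        simp only [mul_add, hp, hq]
    · intro p q hp hq
      simp only [mul_add, add_mul, hp, hq]
  refine ⟨fun p => hcomm p, hleft, fun p q => ?_⟩
  -- Given commutation and left associativity, right associativity reduces to (k p) q = p (k q).
  -- This is where π_i^m must be linear over k.
  rw [← hcomm, ← hcomm, hleft]
  refine induction_on P (C := fun p => const P k * p * q = p * (const P k * q)) p (by simp) ?_ ?_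
  · intro m a
    refine induction_on P (C := fun q => const P k * monomial P m a * q =
      monomial P m a * (const P k * q)) q (by simp) ?_ ?_
    · intro n b
      rw [hl, hl, monomial_mul_monomial, monomial_mul_monomial]
      simp only [OreData.piMap_mul_left hσ hδ]
      refine sum_congr rfl fun i _ => ?_
      rw [(hk.comm a).eq, hk.mid_assoc]
    · intro p q hp hq
      simp only [mul_add, hp, hq]
  · intro p q hp hq
    simp only [mul_add, add_mul, hp, hq]

/-- The coefficient of a constant in the centre of `R[X ; id, δ]` is central in `R`. -/
theorem mem_center_of_const_mem_center {k : R} (hk : const P k ∈ Set.center (OrePoly P)) :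
    k ∈ Set.center R := by
  have hmul : ∀ a b, const P a * const P b = const P (a * b) := fun a b => by
    simp [const, monomial_mul_monomial, P.piMap_zero_zero]
  have hinj : ∀ {a b : R}, const P a = const P b → a = b := fun {a b} h => by
    simpa only [coeff_const_zero] using congrArg (coeff 0) h
  refine ⟨fun a => hinj ?_, fun a b => hinj ?_, fun a b => hinj ?_⟩
  · simpa only [hmul] using (hk.comm (const P a)).eq
  · simpa only [hmul] using hk.left_assoc (const P a) (const P b)
  · simpa only [hmul] using hk.right_assoc (const P a) (const P b)

end OrePoly

/-! ### Consequences of minimality in C(Y) -/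

section Minimal

variable {Y : Type*} [TopologicalSpace Y] {g : C(Y, Y)}

/-- Otherwise Urysohn's lemma makes g the identity; then every singleton is closed and invariant, so
Y has at most one point and is discrete. -/
theorem IsMinimalMap.exists_comp_ne [CompactSpace Y] [T2Space Y] (hmin : IsMinimalMap g)
    (hdisc : ¬ DiscreteTopology Y) : ∃ (r : C(Y, ℝ)) (y : Y), r (g y) ≠ r y := by
  by_contra! h
  have hg : ∀ y, g y = y := by
    intro y
    by_contra hne
    obtain ⟨r, h0, h1, -⟩ := exists_continuous_zero_one_of_isClosed
      (isClosed_singleton (x := g y)) (isClosed_singleton (x := y)) (by simpa using hne)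
    have := h r y
    rw [h0 rfl, h1 rfl] at this
    exact zero_ne_one this
  have : Subsingleton Y := by
    refine ⟨fun x y => ?_⟩
    rcases hmin {y} isClosed_singleton (by simp [hg]) with h | h
    · exact absurd h (Set.singleton_ne_empty y)
    · exact Set.mem_singleton_iff.1 (h ▸ Set.mem_univ x)
  exact hdisc inferInstance

/-- The level sets of an invariant function are closed and invariant. -/
theorem IsMinimalMap.apply_eq_apply {K : Type*} [TopologicalSpace K] [T2Space K] (hmin : IsMinimalMap g)
    {f : C(Y, K)} (hf : ∀ y, f (g y) = f y) (x y : Y) : f x = f y := by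
  rcases hmin {z | f z = f y} (isClosed_eq f.continuous continuous_const)
    (by rintro _ ⟨z, hz, rfl⟩; exact (hf z).trans hz) with h | h
  · exact absurd (show y ∈ {z | f z = f y} from rfl) (h ▸ Set.notMem_empty y)
  · exact (h ▸ Set.mem_univ x : x ∈ {z | f z = f y})

variable {K : Type} [NonAssocRing K] [StarRing K] [Module ℝ K] [TopologicalSpace K]
  [IsQuadraticStarAlgebra K]

/-- A real-valued continuous function, viewed as a function with values in `K`. -/
def ContinuousMap.ofRealValued (K : Type) [NonAssocRing K] [StarRing K] [Module ℝ K]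
    [TopologicalSpace K] [IsQuadraticStarAlgebra K] (r : C(Y, ℝ)) : C(Y, K) :=
  ⟨fun y => r y • (1 : K), by fun_prop⟩

@[simp]
theorem ContinuousMap.ofRealValued_apply (r : C(Y, ℝ)) (y : Y) :
    ofRealValued K r y = r y • (1 : K) := rfl

theorem ContinuousMap.ofRealValued_mul_comm [IsTopologicalRing K] (r : C(Y, ℝ)) (f : C(Y, K)) :
    ofRealValued K r * f = f * ofRealValued K r := by
  ext y
  simp [smul_mul_assoc, mul_smul_comm]

/-- If `g` is minimal, a nonzero `g`-invariant ideal of `C(Y)` contains `1`. -/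
theorem IsMinimalMap.one_mem [IsTopologicalRing K] [ContinuousStar K] [CompactSpace Y]
    (hmin : IsMinimalMap g) (S : AddSubgroup C(Y, K))
    (hl : ∀ a, ∀ f ∈ S, a * f ∈ S) (hr : ∀ a, ∀ f ∈ S, f * a ∈ S) (hg : ∀ f ∈ S, f.comp g ∈ S)
    (hS : S ≠ ⊥) : 1 ∈ S := by
  obtain ⟨N, hNc, hN0, hN, hmul, -⟩ := IsQuadraticStarAlgebra.exists_normSq (A := K)
  -- The common zero set of S is closed and mapped into itself by g; it cannot be Y because S is
  -- nonzero.
  have hne : ∀ y, ∃ f ∈ S, f y ≠ 0 := by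
    by_contra! h
    obtain ⟨y, hy⟩ := h
    have hZ : IsClosed {z | ∀ f ∈ S, f z = 0} := by
      simp only [Set.ofPred_forall]
      exact isClosed_biInter fun f _ => isClosed_eq f.continuous continuous_const
    rcases hmin _ hZ (by rintro _ ⟨z, hz, rfl⟩ f hf; exact hz _ (hg f hf)) with h | h
    · exact Set.notMem_empty y (h ▸ hy)
    · refine hS ((AddSubgroup.eq_bot_iff_forall S).2 fun f hf => ?_)
      ext z
      exact (h ▸ Set.mem_univ z : z ∈ {z | ∀ f ∈ S, f z = 0}) f hf
  -- Locally h is N ∘ f, which lies in S as f f*. Nonnegativity everywhere is carried along so that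
  -- adding functions preserves positivity on each piece of the cover.
  have hpos : ∃ h : C(Y, ℝ), ContinuousMap.ofRealValued K h ∈ S ∧ (∀ y, 0 ≤ h y) ∧
      ∀ y ∈ Set.univ, 0 < h y := by
    refine isCompact_univ.induction_on (p := fun s => ∃ h : C(Y, ℝ),
      ContinuousMap.ofRealValued K h ∈ S ∧ (∀ y, 0 ≤ h y) ∧ ∀ y ∈ s, 0 < h y) ?_ ?_ ?_ ?_
    · refine ⟨0, ?_, by simp, by simp⟩
      convert S.zero_mem
      ext y
      simp
    · rintro s t hst ⟨h, h1, h2, h3⟩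
      exact ⟨h, h1, h2, fun y hy => h3 y (hst hy)⟩
    · rintro s t ⟨h, h1, h2, h3⟩ ⟨k, k1, k2, k3⟩
      refine ⟨h + k, ?_, fun y => add_nonneg (h2 y) (k2 y), ?_⟩
      · convert S.add_mem h1 k1
        ext y
        simp [add_smul]
      · rintro y (hy | hy)
        · exact add_pos_of_pos_of_nonneg (h3 y hy) (k2 y)
        · exact add_pos_of_nonneg_of_pos (h2 y) (k3 y hy)
    · intro y _
      obtain ⟨f, hf, hfy⟩ := hne y
      have hfy' : 0 < N (f y) := (hN0 _).lt_of_ne fun h => hfy (hN _ h.symm)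
      refine ⟨{z | 0 < N (f z)}, mem_nhdsWithin_of_mem_nhds ((isOpen_lt continuous_const
        (hNc.comp f.continuous)).mem_nhds hfy'), ⟨fun z => N (f z), hNc.comp f.continuous⟩, ?_,
        fun z => hN0 _, fun z hz => hz⟩
      convert hr (star f) f hf
      ext z
      exact (hmul (f z)).symm
  obtain ⟨h, hmem, -, hp⟩ := hpos
  have hinv : Continuous fun y => (h y)⁻¹ := h.continuous.inv₀ fun y => (hp y trivial).ne'
  convert hl (ContinuousMap.ofRealValued K ⟨_, hinv⟩) _ hmem
  ext y
  simp [smul_smul, mul_inv_cancel₀ (hp y trivial).ne']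

end Minimal

/-! ### Simplicity and centre of the polynomial ring -/

section DynamicalPolynomials

variable {Y : Type*} [TopologicalSpace Y] {g : C(Y, Y)} {K : Type} [NonAssocRing K] [StarRing K]
  [Module ℝ K] [TopologicalSpace K] [IsTopologicalRing K] [IsQuadraticStarAlgebra K]

open OrePoly

/-- A nonzero polynomial with constant leading coefficient that commutes with the real-valued
functions has degree zero. -/
theorem IsMinimalMap.eq_zero_of_commute [CompactSpace Y] [T2Space Y] (hmin : IsMinimalMap g)
    (hdisc : ¬ DiscreteTopology Y) {p : OrePoly (OreData.ofRingHom (compHom K g))} {N : ℕ}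
    (hp : ∀ m, N < m → coeff m p = 0) {k : K} (hk : k ≠ 0) (hN : ∀ y, coeff N p y = k)
    (hcomm : ∀ r : C(Y, ℝ), p * const _ (ContinuousMap.ofRealValued K r) =
      const _ (ContinuousMap.ofRealValued K r) * p) : N = 0 := by
  cases N with
  | zero => rfl
  | succ N =>
    obtain ⟨r, y, hr⟩ := hmin.exists_comp_ne hdisc
    have h := congrArg (coeff N) (hcomm r)
    rw [coeff_mul_const_pred rfl hp, coeff_const_mul, ContinuousMap.ofRealValued_mul_comm,
      add_eq_left] at h
    have h2 : (N + 1) • (k * (r (g y) • (1 : K) - r y • (1 : K))) = 0 := by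
      rw [← hN y]
      exact DFunLike.congr_fun h y
    -- Since r is real-valued, the equation is a real multiple of k, so zero divisors in K do no
    -- harm.
    rw [← sub_smul, mul_smul_comm, mul_one, ← Nat.cast_smul_eq_nsmul ℝ, smul_eq_zero,
      smul_eq_zero, sub_eq_zero] at h2
    rcases h2 with h2 | h2 | h2
    · exact absurd h2 (Nat.cast_ne_zero.2 N.succ_ne_zero)
    · exact absurd h2 hr
    · exact absurd h2 hk

theorem IsMinimalMap.isSimpleRing [ContinuousStar K] [CompactSpace Y] [T2Space Y]
    (hmin : IsMinimalMap g) (hdisc : ¬ DiscreteTopology Y) :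
    IsSimpleRing (OrePoly (OreData.ofRingHom (compHom K g))) := by
  have hY : Nonempty Y := by
    by_contra h
    rw [not_nonempty_iff] at h
    exact hdisc inferInstance
  have hnt : Nontrivial (TwoSidedIdeal (OrePoly (OreData.ofRingHom (compHom K g)))) := by
    refine ⟨⊥, ⊤, fun h => ?_⟩
    have h1 : (1 : OrePoly (OreData.ofRingHom (compHom K g))) = 0 := by
      have : (1 : OrePoly (OreData.ofRingHom (compHom K g))) ∈ (⊥ : TwoSidedIdeal _) :=
        h ▸ trivial
      simpa using this
    have h2 := congrArg (coeff 0) h1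
    rw [one_def, coeff_monomial, if_pos rfl, map_zero] at h2
    exact one_ne_zero (α := K) (DFunLike.congr_fun h2 hY.some)
  refine ⟨{ eq_bot_or_eq_top := fun I => or_iff_not_imp_left.2 fun hI => ?_ }⟩
  have hex : ∃ N, ∃ p ∈ I, p ≠ 0 ∧ ∀ m, N < m → coeff m p = 0 := by
    by_contra! h
    refine hI (le_bot_iff.1 fun p hp => ?_)
    by_contra hne
    obtain ⟨N, hN⟩ := exists_coeff_eq_zero_of_lt p
    obtain ⟨m, hm, hm'⟩ := h N p hp hne
    exact hm' (hN m hm)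
  classical
  obtain ⟨p, hpI, hp0, hp⟩ := Nat.find_spec hex
  -- Minimality of N, stated so that it also covers N = 0, where the hypothesis kills every
  -- coefficient.
  have hlow : ∀ q ∈ I, (∀ m, Nat.find hex ≤ m → coeff m q = 0) → q = 0 := by
    intro q hq hdeg
    by_contra hne
    rcases Nat.eq_zero_or_pos (Nat.find hex) with h0 | hpos
    · exact hne (ext_coeff fun i => by rw [hdeg i (h0 ▸ Nat.zero_le i), map_zero])
    · exact Nat.find_min hex (Nat.sub_one_lt hpos.ne') ⟨q, hq, hne, fun m hm => hdeg m (by omega)⟩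
  generalize Nat.find hex = N at hp hlow
  let S : AddSubgroup C(Y, K) :=
    { carrier := {f | ∃ q ∈ I, (∀ m, N < m → coeff m q = 0) ∧ coeff N q = f}
      zero_mem' := ⟨0, I.zero_mem, fun m _ => map_zero _, map_zero _⟩
      add_mem' := by
        rintro _ _ ⟨q, hq, hq1, rfl⟩ ⟨s, hs, hs1, rfl⟩
        exact ⟨q + s, I.add_mem hq hs, fun m hm => by rw [map_add, hq1 m hm, hs1 m hm, add_zero],
          map_add _ _ _⟩
      neg_mem' := by
        rintro _ ⟨q, hq, hq1, rfl⟩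
        exact ⟨-q, I.neg_mem hq, fun m hm => by rw [map_neg, hq1 m hm, neg_zero], map_neg _ _⟩ }
  have hone : 1 ∈ S := by
    refine hmin.one_mem S ?_ ?_ ?_ ?_
    · rintro a _ ⟨q, hq, hq1, rfl⟩
      exact ⟨const _ a * q, I.mul_mem_left _ _ hq,
        fun m hm => by rw [coeff_const_mul, hq1 m hm, mul_zero], coeff_const_mul _ _ _⟩
    · rintro a _ ⟨q, hq, hq1, rfl⟩
      exact ⟨q * const _ a, I.mul_mem_right _ _ hq,
        fun m hm => coeff_mul_const_of_lt rfl hq1 hm a, coeff_mul_const_self rfl hq1 a⟩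
    · rintro _ ⟨q, hq, hq1, rfl⟩
      -- Since δ + id is composition with g, the element X q - q X + q of I realizes f ↦ f ∘ g on
      -- coefficients.
      have hc : ∀ i, coeff i (monomial _ 1 1 * q - q * monomial _ 1 1 + q) =
          (coeff i q).comp g := fun i => by
        rw [map_add, map_sub, coeff_mul_monomial_one i q rfl, add_sub_cancel_left]
        ext y
        exact sub_add_cancel _ _
      refine ⟨monomial _ 1 1 * q - q * monomial _ 1 1 + q, I.add_mem (I.sub_mem
        (I.mul_mem_left _ _ hq) (I.mul_mem_right _ _ hq)) hq, fun m hm => ?_, hc N⟩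
      rw [hc, hq1 m hm, ContinuousMap.zero_comp]
    · intro hbot
      refine hp0 (hlow p hpI fun m hm => ?_)
      rcases hm.eq_or_lt with rfl | hm
      · exact (AddSubgroup.eq_bot_iff_forall S).1 hbot _ ⟨p, hpI, hp, rfl⟩
      · exact hp m hm
  obtain ⟨q, hqI, hq, hq1⟩ := hone
  have hN : N = 0 := by
    -- The commutator of q with r lies in I and its coefficient at X^N is 1 · r - r · 1 = 0, so
    -- `hlow` makes it vanish.
    refine hmin.eq_zero_of_commute hdisc hq one_ne_zero (fun y => by rw [hq1]; rfl) fun r =>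
      sub_eq_zero.1 (hlow _ (I.sub_mem (I.mul_mem_right _ _ hqI) (I.mul_mem_left _ _ hqI))
        fun m hm => ?_)
    rw [map_sub, coeff_const_mul]
    rcases hm.eq_or_lt with rfl | hm
    · rw [coeff_mul_const_self rfl hq, hq1, one_mul, mul_one, sub_self]
    · rw [coeff_mul_const_of_lt rfl hq hm, hq m hm, mul_zero, sub_self]
  subst hN
  rw [eq_const hq, hq1] at hqI
  exact I.one_mem_iff.1 hqI

theorem IsMinimalMap.center_eq [CompactSpace Y] [T2Space Y] (hmin : IsMinimalMap g)
    (hdisc : ¬ DiscreteTopology Y) :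
    Set.center (OrePoly (OreData.ofRingHom (compHom K g))) =
      (fun k => const _ (ContinuousMap.const Y k)) '' Set.center K := by
  have hY : Nonempty Y := by
    by_contra h
    rw [not_nonempty_iff] at h
    exact hdisc inferInstance
  ext p
  constructor
  · intro hp
    -- Commuting with X means that δ kills every coefficient.
    have hinv : ∀ i x y, coeff i p x = coeff i p y := fun i => hmin.apply_eq_apply fun y => by
      have h := congrArg (coeff i) (hp.comm (monomial _ 1 1)).eq
      rw [coeff_mul_monomial_one i p rfl, left_eq_add] at h
      exact sub_eq_zero.1 (DFunLike.congr_fun h y)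
    have hpc : ∃ k, p = const _ (ContinuousMap.const Y k) := by
      have hex := exists_coeff_eq_zero_of_lt p
      classical
      have hdeg := Nat.find_spec hex
      have hN : Nat.find hex = 0 := by
        -- If the least degree bound is positive, the coefficient there is a nonzero constant, and
        -- commuting with the real-valued functions gives the contradiction.
        by_contra h0
        have hne : ∃ y, coeff (Nat.find hex) p y ≠ 0 := by
          by_contra! h
          refine Nat.find_min hex (Nat.sub_one_lt h0) fun i hi => ?_
          rcases (show Nat.find hex ≤ i by omega).eq_or_lt with hi' | hi'
          · rw [← hi']
            ext y
            exact h y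
          · exact hdeg i hi'
        obtain ⟨y, hy⟩ := hne
        exact h0 (hmin.eq_zero_of_commute hdisc hdeg hy (fun x => hinv _ x y)
          fun r => (hp.comm _).eq)
      rw [hN] at hdeg
      refine ⟨coeff 0 p hY.some, (eq_const hdeg).trans (congrArg _ ?_)⟩
      ext y
      exact hinv 0 y _
    obtain ⟨k, rfl⟩ := hpc
    have hk := mem_center_of_const_mem_center hp
    refine ⟨k, ⟨fun a => ?_, fun a b => ?_, fun a b => ?_⟩, rfl⟩
    · exact DFunLike.congr_fun (hk.comm (ContinuousMap.const Y a)).eq hY.some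
    · exact DFunLike.congr_fun (hk.left_assoc (ContinuousMap.const Y a) (ContinuousMap.const Y b))
        hY.some
    · exact DFunLike.congr_fun (hk.right_assoc (ContinuousMap.const Y a) (ContinuousMap.const Y b))
        hY.some
  · rintro ⟨k, hk, rfl⟩
    refine const_mem_center rfl ⟨fun a => ?_, fun a b => ?_, fun a b => ?_⟩ fun b => ?_
    · ext y
      exact (hk.comm (a y)).eq
    · ext y
      exact hk.left_assoc (a y) (b y)
    · ext y
      exact hk.right_assoc (a y) (b y)
    · ext y
      exact (mul_sub k (b (g y)) (b y)).symm

end DynamicalPolynomials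

theorem theorem6p6 {Y : Type*} [TopologicalSpace Y] [CompactSpace Y] [T2Space Y]
    (n : ℕ) (g : C(Y, Y)) (hmin : IsMinimalMap g) (hdisc : ¬ DiscreteTopology Y) :
    IsSimpleRing (DynPoly n g) ∧
    (n = 1 → Set.center (DynPoly n g) = Set.range (DynPoly.scalar n g)) ∧
    (n ≠ 1 → Set.center (DynPoly n g) =
      Set.range fun r : ℝ => DynPoly.scalar n g (r • (1 : CDAlgebra n))) := by
  refine ⟨hmin.isSimpleRing hdisc, ?_, fun hn => ?_⟩
  · rintro rfl
    rw [hmin.center_eq hdisc, CDAlgebra.center_one, Set.image_univ]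
    rfl
  · rw [hmin.center_eq hdisc]
    ext p
    constructor
    · rintro ⟨k, hk, rfl⟩
      obtain ⟨r, rfl⟩ := CDAlgebra.exists_eq_smul_one_of_mem_center hn k hk
      exact ⟨r, rfl⟩
    · rintro ⟨r, rfl⟩
      exact ⟨r • 1, smul_one_mem_center r, rfl⟩
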